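/- For a lattice $\Lambda\subset\mathbb R^d$ (the $\mathbb Z$-span of a basis of $\mathbb R^d$), let $\mathbb T=\mathbb R^d/\Lambda$ be the flat torus with the metric induced by the Euclidean metric, and let $\Delta$ be its Laplace–Beltrami operator. Let $(e_j)_{j\ge 0}$ be a complete orthonormal system of $L^2(\mathbb T)$ (with respect to the Riemannian volume) consisting of smooth eigenfunctions, $-\Delta e_j=\lambda_j^2e_j$ with $0\le\lambda_0\le\lambda_1\le\cdots$. Such a system exists, and the local Weyl counting function $$N_{\mathbb T}(x,\lambda)=\sum_{\lambda_j\le\lambda}|e_j(x)|^2\qquad(x\in\mathbb T,\ \lambda\in\mathbb R)$$ does not depend on its choice. **Proposition.** For every integer $d\ge 4$ there exist two non-isometric flat tori $\mathbb T$ and $\mathbb T'$ of dimension $d$ whose local Weyl counting functions are identical everywhere: there is a function $f:\mathbb R\to[0,\infty)$ such that $$N_{\mathbb T}(x,\lambda)=N_{\mathbb T'}(y,\lambda)=f(\lambda)\qquad\text{for all }x\in\mathbb T,\ y\in\mathbb T',\ \lambda\in\mathbb R .$$ -/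

import Mathlib

open MeasureTheory
open scoped NNReal ENNReal ContDiff InnerProductSpace

/-- The flat torus `ℝᵈ / Λ`, where `Λ = ℤ b₁ + ⋯ + ℤ b_d` is the lattice spanned by the basis `b` of
Euclidean space `ℝᵈ`.  Mathlib equips this quotient of a normed group with the quotient topology and
with the distance `dist (v + Λ) (w + Λ) = inf {‖v - w + l‖ | l ∈ Λ}`, which is the Riemannian
distance of the flat metric that the Euclidean metric induces on the quotient. -/
abbrev FlatTorus {d : ℕ} (b : Module.Basis (Fin d) ℝ (EuclideanSpace ℝ (Fin d))) : Type :=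
  EuclideanSpace ℝ (Fin d) ⧸ (Submodule.span ℤ (Set.range b)).toAddSubgroup

namespace FlatTorus

variable {d : ℕ} (b : Module.Basis (Fin d) ℝ (EuclideanSpace ℝ (Fin d)))

/-- The projection `ℝᵈ → ℝᵈ / Λ`; it is the Riemannian universal covering. -/
def proj (v : EuclideanSpace ℝ (Fin d)) : FlatTorus b := QuotientAddGroup.mk v

/-- The Riemannian volume measure of the flat torus: the image under the projection of Lebesgue
measure on the half-open fundamental parallelepiped `{∑ tᵢ bᵢ | 0 ≤ tᵢ < 1}`. -/
noncomputable def vol : Measure (FlatTorus b) :=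
  Measure.map (proj b) (volume.restrict (ZSpan.fundamentalDomain b))

/-- Smoothness of a function on the torus. As the projection is a surjective local diffeomorphism,
this is smoothness of the lift to `ℝᵈ`. -/
def IsSmooth (f : FlatTorus b → ℂ) : Prop := ContDiff ℝ ∞ (f ∘ proj b)

/-- The Laplace-Beltrami operator `Δ` of the flat torus. As the projection is a local isometry, the
value at a point `x` is the Euclidean Laplacian of the lift at any point above `x`. -/
noncomputable def laplaceBeltrami (f : FlatTorus b → ℂ) (x : FlatTorus b) : ℂ :=
  Laplacian.laplacian (f ∘ proj b) (Quotient.out x)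

/-- The Laplace-Beltrami operator does not depend on the chosen lift of the point. -/
theorem laplaceBeltrami_proj (f : FlatTorus b → ℂ) (v : EuclideanSpace ℝ (Fin d)) :
    laplaceBeltrami b f (proj b v) = Laplacian.laplacian (f ∘ proj b) v := by
  obtain ⟨l, hl⟩ := QuotientAddGroup.mk_out_eq_add
    (Submodule.span ℤ (Set.range b)).toAddSubgroup v
  have hper : (fun w => (f ∘ proj b) (w + (l : EuclideanSpace ℝ (Fin d)))) = f ∘ proj b := by
    funext w
    simp only [Function.comp_apply, proj]
    congr 1
    exact QuotientAddGroup.mk_add_of_mem w l.2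
  unfold laplaceBeltrami
  change Laplacian.laplacian (f ∘ proj b) (Quotient.out (QuotientAddGroup.mk v)) = _
  rw [hl]
  simp only [InnerProductSpace.laplacian_eq_iteratedFDeriv_stdOrthonormalBasis]
  rw [← iteratedFDeriv_comp_add_right, hper]

/-- A complete orthonormal system of Laplace-Beltrami eigenfunctions of the flat torus,
`-Δ e_j = λ_j² e_j` with `0 ≤ λ_0 ≤ λ_1 ≤ ⋯`.  The eigenfunctions may be complex valued; a real
valued orthonormal eigenbasis is the special case in which all `e_j` are real. -/
structure EigenSystem where
  /-- The square roots `λ_j` of the eigenvalues, listed with multiplicity. -/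
  freq : ℕ → ℝ
  /-- The eigenfunctions `e_j`. -/
  e : ℕ → FlatTorus b → ℂ
  freq_nonneg : ∀ j, 0 ≤ freq j
  freq_mono : Monotone freq
  smooth : ∀ j, IsSmooth b (e j)
  eigen : ∀ j x, -laplaceBeltrami b (e j) x = ((freq j ^ 2 : ℝ) : ℂ) * e j x
  /-- The `e_j` form a Hilbert basis (complete orthonormal system) of `L²`. -/
  basis : HilbertBasis ℕ ℂ (Lp ℂ 2 (vol b))
  basis_ae : ∀ j, (basis j : FlatTorus b → ℂ) =ᵐ[vol b] e j

/-- The local Weyl counting function `N(x, t) = ∑_{λ_j ≤ t} |e_j(x)|²`, as a sum in `[0, ∞]`. -/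
noncomputable def localWeyl {b : Module.Basis (Fin d) ℝ (EuclideanSpace ℝ (Fin d))}
    (S : EigenSystem b) (x : FlatTorus b) (t : ℝ) : ℝ≥0∞ :=
  ∑' j : {j : ℕ // S.freq j ≤ t}, ‖S.e j x‖ₑ ^ 2

end FlatTorus

/-!
The eigenfunctions of `ℝᵈ / Λ` are spanned by the characters `exp (2πi⟪ξ, x⟫)`, where `ξ` runs over
the dual lattice `Λ*`, with eigenvalues `(2π‖ξ‖)²`. Parseval's identity for the reproducing kernel
`∑ conj (χ_ξ x) χ_ξ` over `2π‖ξ‖ ≤ t` allows any orthonormal eigenbasis to be replaced by these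
characters, so `N(x, t) = #{ξ ∈ Λ* | 2π‖ξ‖ ≤ t} / vol (ℝᵈ / Λ)` for every `x`. It is thus enough to
find isospectral lattices `Λ*` of the same covolume that are not isometric, because an isometry
between flat tori lifts to a linear isometry between their lattices. In dimension four we take two
lattices of Conway and Sloane, and in higher dimension we add a rectangular lattice with long
generators.
-/

/-! ### Enumeration of a family by increasing value -/

theorem nonempty_orderIso_nat {α : Type*} [LinearOrder α] [Infinite α]
    (hfin : ∀ a : α, (Set.Iio a).Finite) : Nonempty (ℕ ≃o α) := by
  classical
  have hmono : StrictMono fun a : α => (Set.Iio a).ncard := fun a c hac =>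
    Set.ncard_lt_ncard ((Set.ssubset_iff_of_subset (Set.Iio_subset_Iio hac.le)).2
      ⟨a, hac, lt_irrefl a⟩) (hfin c)
  have : Infinite (Set.range fun a : α => (Set.Iio a).ncard) :=
    (Set.infinite_range_of_injective hmono.injective).to_subtype
  exact ⟨(Nat.Subtype.orderIsoOfNat _).trans (hmono.orderIso _).symm⟩

theorem exists_equiv_nat_monotone {α : Type*} [Infinite α] (f : α → ℝ)
    (hfin : ∀ t, {a | f a ≤ t}.Finite) : ∃ σ : ℕ ≃ α, Monotone (f ∘ σ) := by
  let key : α → ℝ ×ₗ Cardinal := fun a => toLex (f a, embeddingToCardinal a)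
  have key_injective : key.Injective := fun a c h =>
    embeddingToCardinal.injective (congrArg (fun p => (ofLex p).2) h)
  let : LinearOrder α := LinearOrder.lift' key key_injective
  have f_mono : Monotone f := fun a c h => Prod.Lex.monotone_fst (key a) (key c) h
  obtain ⟨σ⟩ := nonempty_orderIso_nat fun a : α =>
    (hfin (f a)).subset fun c (hc : c < a) => f_mono hc.le
  exact ⟨σ.toEquiv, f_mono.comp σ.monotone⟩

/-! ### Plane waves -/

section PlaneWave

variable {E : Type*} [NormedAddCommGroup E] [InnerProductSpace ℝ E]

/-- The plane wave `v ↦ exp (2πi ⟪ξ, v⟫)` with wave vector `ξ`. -/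
noncomputable def planeWave (ξ v : E) : ℂ := Real.fourierChar ⟪ξ, v⟫_ℝ

theorem planeWave_zero_left (v : E) : planeWave 0 v = 1 := by simp [planeWave]

theorem planeWave_add_left (ξ η v : E) :
    planeWave (ξ + η) v = planeWave ξ v * planeWave η v := by
  simp [planeWave, inner_add_left, AddChar.map_add_eq_mul]

theorem planeWave_add_right (ξ v w : E) :
    planeWave ξ (v + w) = planeWave ξ v * planeWave ξ w := by
  simp [planeWave, inner_add_right, AddChar.map_add_eq_mul]

theorem planeWave_neg_left (ξ v : E) : planeWave (-ξ) v = star (planeWave ξ v) := by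
  simp [planeWave, inner_neg_left, AddChar.map_neg_eq_inv]

theorem norm_planeWave (ξ v : E) : ‖planeWave ξ v‖ = 1 := Circle.norm_coe _

theorem planeWave_eq_one_iff {ξ v : E} : planeWave ξ v = 1 ↔ ∃ k : ℤ, ⟪ξ, v⟫_ℝ = k := by
  rw [planeWave, Real.fourierChar_apply, Complex.exp_eq_one_iff]
  refine exists_congr fun k => ?_
  rw [Complex.ofReal_mul, mul_right_comm, mul_comm, ← Complex.ofReal_intCast,
    ← Complex.ofReal_inj]
  push_cast
  exact mul_left_inj' Complex.two_pi_I_ne_zero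

theorem planeWave_sub_right_eq_one_iff {ξ v w : E} :
    planeWave ξ (v - w) = 1 ↔ planeWave ξ v = planeWave ξ w := by
  have hw : planeWave ξ w ≠ 0 := Circle.coe_ne_zero _
  rw [← mul_left_inj' hw, ← planeWave_add_right, sub_add_cancel, one_mul]

theorem hasFDerivAt_planeWave (ξ v : E) :
    HasFDerivAt (planeWave ξ)
      ((2 * Real.pi * Complex.I * planeWave ξ v) • Complex.ofRealCLM.comp (innerSL ℝ ξ)) v := by
  convert! (Real.hasDerivAt_fourierChar (innerSL ℝ ξ v)).hasFDerivAt.comp v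
    (innerSL ℝ ξ).hasFDerivAt using 1
  ext w
  simp [planeWave, mul_comm]

theorem fderiv_planeWave_apply (ξ v w : E) :
    fderiv ℝ (planeWave ξ) v w = 2 * Real.pi * Complex.I * ⟪ξ, w⟫_ℝ * planeWave ξ v := by
  simp [(hasFDerivAt_planeWave ξ v).fderiv]
  ring

theorem contDiff_planeWave (ξ : E) : ContDiff ℝ ∞ (planeWave ξ) := by
  have h : ContDiff ℝ ∞ fun v : E => ((2 * Real.pi * ⟪ξ, v⟫_ℝ : ℝ) : ℂ) * Complex.I :=
    (Complex.ofRealCLM.contDiff.comp (contDiff_const.mul (innerSL ℝ ξ).contDiff)).mul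
      contDiff_const
  exact h.cexp

variable [FiniteDimensional ℝ E]

theorem laplacian_eq_sum_fderiv {F : E → ℂ} (hF : ContDiff ℝ 2 F) (v : E) :
    Laplacian.laplacian F v = ∑ i, fderiv ℝ (fun x => fderiv ℝ F x (stdOrthonormalBasis ℝ E i)) v
      (stdOrthonormalBasis ℝ E i) := by
  have hF' : Differentiable ℝ (fderiv ℝ F) :=
    (hF.fderiv_right (m := 1) (by norm_num)).differentiable one_ne_zero
  rw [InnerProductSpace.laplacian_eq_iteratedFDeriv_stdOrthonormalBasis]
  refine Finset.sum_congr rfl fun i _ => ?_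
  rw [iteratedFDeriv_two_apply, fderiv_clm_apply (hF' v) (by fun_prop)]
  simp

theorem laplacian_planeWave (ξ v : E) :
    Laplacian.laplacian (planeWave ξ) v =
      -(((2 * Real.pi * ‖ξ‖) ^ 2 : ℝ) : ℂ) * planeWave ξ v := by
  have second_deriv (w : E) : fderiv ℝ (fun x => fderiv ℝ (planeWave ξ) x w) v w =
      -(((2 * Real.pi) ^ 2 * ⟪ξ, w⟫_ℝ ^ 2 : ℝ) : ℂ) * planeWave ξ v := by
    simp_rw [fderiv_planeWave_apply]
    rw [fderiv_const_mul (hasFDerivAt_planeWave ξ v).differentiableAt,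
      smul_apply, fderiv_planeWave_apply, smul_eq_mul]
    push_cast
    linear_combination ((2 * Real.pi) ^ 2 * ⟪ξ, w⟫_ℝ ^ 2 * planeWave ξ v) * Complex.I_sq
  simp_rw [laplacian_eq_sum_fderiv ((contDiff_planeWave ξ).of_le (by norm_cast)),
    second_deriv, ← Finset.sum_mul, Finset.sum_neg_distrib, ← Complex.ofReal_sum,
    ← Finset.mul_sum]
  have parseval := (stdOrthonormalBasis ℝ E).sum_sq_norm_inner_left ξ
  simp only [Real.norm_eq_abs, sq_abs] at parseval
  rw [parseval, ← mul_pow]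

end PlaneWave

/-! ### Periodic functions over a period parallelepiped -/

section Periodic

variable {E : Type*} [NormedAddCommGroup E] [NormedSpace ℝ E] {ι : Type*}
  (b : Module.Basis ι ℝ E) {F : Type*} [NormedAddCommGroup F]

theorem periodic_fderiv [NormedSpace ℝ F] {H : E → F} {l : E} (hper : Function.Periodic H l) :
    Function.Periodic (fderiv ℝ H) l := fun v => by
  rw [← fderiv_comp_add_right, hper.funext]

theorem exists_norm_le_of_periodic [Finite ι] {H : E → F} (hH : Continuous H)
    (hper : ∀ l ∈ Submodule.span ℤ (Set.range b), Function.Periodic H l) :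
    ∃ C, ∀ v, ‖H v‖ ≤ C := by
  have := b.finiteDimensional_of_finite
  obtain ⟨C, hC⟩ := (IsZLattice.isCompact_range_of_periodic (Submodule.span ℤ (Set.range b)) H hH
    fun v l hl => hper l hl v).isBounded.exists_norm_le
  exact ⟨C, fun v => hC _ ⟨v, rfl⟩⟩

variable [Finite ι]

instance : Countable (Submodule.span ℤ (Set.range b)).toAddSubgroup :=
  inferInstanceAs (Countable (Submodule.span ℤ (Set.range b)))

variable [MeasurableSpace E] [BorelSpace E] (μ : Measure E) [μ.IsAddHaarMeasure]

theorem integrableOn_fundamentalDomain {H : E → F} (hH : Continuous H) :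
    IntegrableOn H (ZSpan.fundamentalDomain b) μ := by
  have := b.finiteDimensional_of_finite
  have : ProperSpace E := FiniteDimensional.proper_real E
  exact (hH.continuousOn.integrableOn_compact
    (ZSpan.fundamentalDomain_isBounded b).isCompact_closure).mono_set subset_closure

variable [NormedSpace ℝ F]

open scoped Pointwise in
theorem setIntegral_fundamentalDomain_comp_add_right {H : E → F}
    (hper : ∀ l ∈ Submodule.span ℤ (Set.range b), Function.Periodic H l) (w : E) :
    ∫ v in ZSpan.fundamentalDomain b, H (v + w) ∂μ = ∫ v in ZSpan.fundamentalDomain b, H v ∂μ := by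
  have := b.finiteDimensional_of_finite
  have : ProperSpace E := FiniteDimensional.proper_real E
  have hfd := ZSpan.isAddFundamentalDomain' b μ
  calc ∫ v in ZSpan.fundamentalDomain b, H (v + w) ∂μ
      = ∫ v in (· + w) '' ZSpan.fundamentalDomain b, H v ∂μ :=
        ((measurePreserving_add_right μ w).setIntegral_image_emb
          (measurableEmbedding_addRight w) H _).symm
    _ = ∫ v in w +ᵥ ZSpan.fundamentalDomain b, H v ∂μ := by
        simp_rw [← Set.image_vadd, vadd_eq_add, add_comm w]
    _ = ∫ v in ZSpan.fundamentalDomain b, H v ∂μ :=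
        (hfd.vadd_of_comm w).setIntegral_eq hfd fun l v => by
          rw [AddSubgroup.vadd_def, vadd_eq_add, add_comm, hper _ l.2 v]

theorem setIntegral_fundamentalDomain_fderiv_eq_zero {H : E → F} (hH : ContDiff ℝ 1 H)
    (hper : ∀ l ∈ Submodule.span ℤ (Set.range b), Function.Periodic H l) (w : E) :
    ∫ v in ZSpan.fundamentalDomain b, fderiv ℝ H v w ∂μ = 0 := by
  have := b.finiteDimensional_of_finite
  have : ProperSpace E := FiniteDimensional.proper_real E
  have continuous_fderiv := hH.continuous_fderiv one_ne_zero
  obtain ⟨C, hC⟩ := exists_norm_le_of_periodic b continuous_fderiv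
    fun l hl => periodic_fderiv (hper l hl)
  have hasDerivAt_line (v : E) (s : ℝ) :
      HasDerivAt (fun s : ℝ => H (v + s • w)) (fderiv ℝ H (v + s • w) w) s := by
    have h : HasDerivAt (fun s : ℝ => v + s • w) w s := by
      simpa using ((hasDerivAt_id s).smul_const w).const_add v
    exact (hH.differentiable one_ne_zero _).hasFDerivAt.comp_hasDerivAt s h
  have hasDerivAt_integral : HasDerivAt
      (fun s : ℝ => ∫ v in ZSpan.fundamentalDomain b, H (v + s • w) ∂μ)
      (∫ v in ZSpan.fundamentalDomain b, fderiv ℝ H (v + (0 : ℝ) • w) w ∂μ) 0 :=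
    (hasDerivAt_integral_of_dominated_loc_of_deriv_le (bound := fun _ => C * ‖w‖)
      Filter.univ_mem
      (.of_forall fun s => (hH.continuous.comp (by fun_prop)).aestronglyMeasurable)
      (integrableOn_fundamentalDomain b μ (hH.continuous.comp (by fun_prop)))
      (Continuous.aestronglyMeasurable (by fun_prop))
      (.of_forall fun v s _ => ContinuousLinearMap.le_of_opNorm_le _ (hC _) _)
      (integrableOn_fundamentalDomain b μ continuous_const)
      (.of_forall fun v s _ => hasDerivAt_line v s)).2
  simp_rw [setIntegral_fundamentalDomain_comp_add_right b μ hper, zero_smul, add_zero]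
    at hasDerivAt_integral
  exact hasDerivAt_integral.unique (hasDerivAt_const _ _)

end Periodic

theorem setIntegral_fundamentalDomain_fderiv_mul {E : Type*} [NormedAddCommGroup E]
    [NormedSpace ℝ E] {ι : Type*} [Finite ι] (b : Module.Basis ι ℝ E) [MeasurableSpace E]
    [BorelSpace E] (μ : Measure E) [μ.IsAddHaarMeasure] {F G : E → ℂ} (hF : ContDiff ℝ 1 F)
    (hG : ContDiff ℝ 1 G)
    (hFper : ∀ l ∈ Submodule.span ℤ (Set.range b), Function.Periodic F l)
    (hGper : ∀ l ∈ Submodule.span ℤ (Set.range b), Function.Periodic G l) (w : E) :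
    ∫ v in ZSpan.fundamentalDomain b, fderiv ℝ F v w * G v ∂μ =
      -∫ v in ZSpan.fundamentalDomain b, F v * fderiv ℝ G v w ∂μ := by
  have leibniz (v : E) :
      fderiv ℝ (fun x => F x * G x) v w = F v * fderiv ℝ G v w + fderiv ℝ F v w * G v := by
    rw [fderiv_fun_mul (hF.differentiable one_ne_zero v) (hG.differentiable one_ne_zero v)]
    simp [mul_comm (G v)]
  have h := setIntegral_fundamentalDomain_fderiv_eq_zero b μ (hF.mul hG)
    (fun l hl v => by simp [hFper l hl v, hGper l hl v]) w
  simp_rw [leibniz] at h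
  have integrableOn_mul {K L : E → ℂ} (hK : ContDiff ℝ 1 K) (hL : ContDiff ℝ 1 L) :
      Integrable (fun v => K v * fderiv ℝ L v w) (μ.restrict (ZSpan.fundamentalDomain b)) :=
    integrableOn_fundamentalDomain b μ
      (hK.continuous.mul ((hL.continuous_fderiv one_ne_zero).clm_apply continuous_const))
  rw [integral_add (integrableOn_mul hF hG)
    (by simpa only [mul_comm] using integrableOn_mul hG hF)] at h
  linear_combination h

theorem setIntegral_fundamentalDomain_laplacian_mul {E : Type*} [NormedAddCommGroup E]
    [InnerProductSpace ℝ E] [FiniteDimensional ℝ E] {ι : Type*} [Finite ι]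
    (b : Module.Basis ι ℝ E) [MeasurableSpace E] [BorelSpace E] (μ : Measure E)
    [μ.IsAddHaarMeasure] {F G : E → ℂ} (hF : ContDiff ℝ 2 F) (hG : ContDiff ℝ 2 G)
    (hFper : ∀ l ∈ Submodule.span ℤ (Set.range b), Function.Periodic F l)
    (hGper : ∀ l ∈ Submodule.span ℤ (Set.range b), Function.Periodic G l) :
    ∫ v in ZSpan.fundamentalDomain b, Laplacian.laplacian F v * G v ∂μ =
      ∫ v in ZSpan.fundamentalDomain b, F v * Laplacian.laplacian G v ∂μ := by
  have contDiff_partial {K : E → ℂ} (hK : ContDiff ℝ 2 K) (w : E) :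
      ContDiff ℝ 1 fun x => fderiv ℝ K x w :=
    (hK.fderiv_right (by norm_num)).clm_apply contDiff_const
  have periodic_partial {K : E → ℂ}
      (hK : ∀ l ∈ Submodule.span ℤ (Set.range b), Function.Periodic K l) (w : E) :
      ∀ l ∈ Submodule.span ℤ (Set.range b), Function.Periodic (fun x => fderiv ℝ K x w) l :=
    fun l hl v => congrArg (· w) (periodic_fderiv (hK l hl) v)
  have continuous_second {K : E → ℂ} (hK : ContDiff ℝ 2 K) (w : E) :
      Continuous fun v => fderiv ℝ (fun x => fderiv ℝ K x w) v w :=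
    ((contDiff_partial hK w).continuous_fderiv one_ne_zero).clm_apply continuous_const
  simp_rw [laplacian_eq_sum_fderiv hF, laplacian_eq_sum_fderiv hG, Finset.sum_mul, Finset.mul_sum]
  rw [integral_finsetSum, integral_finsetSum]
  rotate_left
  · exact fun i _ => integrableOn_fundamentalDomain b μ
      (hF.continuous.mul (continuous_second hG _))
  · exact fun i _ => integrableOn_fundamentalDomain b μ
      ((continuous_second hF _).mul hG.continuous)
  refine Finset.sum_congr rfl fun i _ => ?_
  rw [setIntegral_fundamentalDomain_fderiv_mul b μ (contDiff_partial hF _)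
      (hG.of_le one_le_two) (periodic_partial hFper _) hGper,
    setIntegral_fundamentalDomain_fderiv_mul b μ (hF.of_le one_le_two)
      (contDiff_partial hG _) hFper (periodic_partial hGper _), neg_neg]

/-! ### The dual lattice -/

section DualLattice

variable {E : Type*} [NormedAddCommGroup E] [InnerProductSpace ℝ E]

/-- The dual lattice `Λ* = {ξ | ⟪ξ, l⟫ ∈ ℤ for all l ∈ Λ}`. -/
noncomputable def dualLattice (Λ : Submodule ℤ E) : Submodule ℤ E :=
  LinearMap.BilinForm.dualSubmodule (innerₗ E) Λ

theorem mem_dualLattice {Λ : Submodule ℤ E} {ξ : E} :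
    ξ ∈ dualLattice Λ ↔ ∀ l ∈ Λ, ∃ k : ℤ, ⟪ξ, l⟫_ℝ = k := by
  simp only [dualLattice, LinearMap.BilinForm.mem_dualSubmodule, Submodule.mem_one,
    innerₗ_apply_apply, algebraMap_int_eq, eq_intCast, eq_comm]

theorem nondegenerate_innerₗ : (innerₗ E).Nondegenerate :=
  (LinearMap.IsRefl.nondegenerate_iff_separatingLeft isSymm_inner.isRefl).2
    fun _ h => inner_self_eq_zero.1 (h _)

variable {ι : Type*} [Finite ι]

/-- The basis `c` dual to `b` for the inner product: `⟪c i, b j⟫ = δᵢⱼ`. -/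
noncomputable def dualBasis [DecidableEq ι] (b : Module.Basis ι ℝ E) : Module.Basis ι ℝ E :=
  LinearMap.BilinForm.dualBasis (innerₗ E) nondegenerate_innerₗ b

theorem inner_dualBasis [DecidableEq ι] (b : Module.Basis ι ℝ E) (i j : ι) :
    ⟪dualBasis b i, b j⟫_ℝ = if j = i then 1 else 0 :=
  LinearMap.BilinForm.apply_dualBasis_left nondegenerate_innerₗ b i j

theorem dualLattice_span [DecidableEq ι] (b : Module.Basis ι ℝ E) :
    dualLattice (Submodule.span ℤ (Set.range b)) =
      Submodule.span ℤ (Set.range (dualBasis b)) :=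
  LinearMap.BilinForm.dualSubmodule_span_of_basis _ _ b

theorem dualBasis_dualBasis [DecidableEq ι] (b : Module.Basis ι ℝ E) :
    dualBasis (dualBasis b) = b :=
  LinearMap.BilinForm.dualBasis_dualBasis _ ⟨fun x y => real_inner_comm y x⟩ b

theorem finite_norm_le_dualLattice (b : Module.Basis ι ℝ E) (r : ℝ) :
    {ξ : dualLattice (Submodule.span ℤ (Set.range b)) | ‖(ξ : E)‖ ≤ r}.Finite := by
  classical
  have := b.finiteDimensional_of_finite
  have : ProperSpace E := FiniteDimensional.proper_real E
  have h := ZSpan.setFinite_inter (dualBasis b) (Metric.isBounded_closedBall (x := 0) (r := r))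
  refine .of_finite_image (h.subset ?_) Subtype.val_injective.injOn
  rintro _ ⟨ξ, hξ, rfl⟩
  exact ⟨mem_closedBall_zero_iff.2 hξ, dualLattice_span b ▸ ξ.2⟩

end DualLattice

namespace FlatTorus

variable {d : ℕ} (b : Module.Basis (Fin d) ℝ (EuclideanSpace ℝ (Fin d)))

/-! ### The torus as a measure space -/

theorem continuous_proj : Continuous (proj b) := continuous_quotient_mk'

theorem proj_surjective : Function.Surjective (proj b) := QuotientAddGroup.mk_surjective

theorem proj_eq_proj_iff {v w : EuclideanSpace ℝ (Fin d)} :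
    proj b v = proj b w ↔ v - w ∈ Submodule.span ℤ (Set.range b) := by
  rw [proj, proj, QuotientAddGroup.eq_iff_sub_mem, Submodule.mem_toAddSubgroup]

theorem periodic_comp_proj {α : Type*} (f : FlatTorus b → α) :
    ∀ l ∈ Submodule.span ℤ (Set.range b), Function.Periodic (f ∘ proj b) l := fun l hl v =>
  congrArg f ((proj_eq_proj_iff b).2 (by rwa [add_sub_cancel_left]))

instance : CompactSpace (FlatTorus b) := by
  rw [← isCompact_univ_iff, ← (proj_surjective b).range_eq]
  exact IsZLattice.isCompact_range_of_periodic (Submodule.span ℤ (Set.range b)) _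
    (continuous_proj b) fun v l hl => periodic_comp_proj b id l hl v

instance : IsFiniteMeasure (vol b) := by
  have : IsFiniteMeasure (volume.restrict (ZSpan.fundamentalDomain b)) :=
    ⟨by simpa using (ZSpan.fundamentalDomain_isBounded b).measure_lt_top⟩
  exact Measure.isFiniteMeasure_map _ _

theorem vol_real_univ : (vol b).real Set.univ = volume.real (ZSpan.fundamentalDomain b) := by
  rw [measureReal_def, vol, Measure.map_apply (continuous_proj b).measurable .univ,
    Set.preimage_univ, Measure.restrict_apply_univ, measureReal_def]

theorem vol_real_univ_pos : 0 < (vol b).real Set.univ := by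
  rw [vol_real_univ]
  exact ENNReal.toReal_pos (ZSpan.measure_fundamentalDomain_ne_zero b)
    (ZSpan.fundamentalDomain_isBounded b).measure_lt_top.ne

instance : (vol b).IsOpenPosMeasure := by
  refine ⟨fun U hU hne hzero => ?_⟩
  have hopen := hU.preimage (continuous_proj b)
  rw [vol, Measure.map_apply (continuous_proj b).measurable hU.measurableSet,
    Measure.restrict_apply hopen.measurableSet] at hzero
  refine hopen.measure_ne_zero volume (hne.preimage (proj_surjective b))
    ((ZSpan.isAddFundamentalDomain' b volume).measure_zero_of_invariant _ (fun l => ?_) hzero)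
  ext v
  rw [Set.mem_vadd_set_iff_neg_vadd_mem, AddSubgroup.vadd_def, vadd_eq_add, add_comm]
  exact iff_of_eq (periodic_comp_proj b (· ∈ U) _ (-l).2 v)

theorem integral_vol {f : FlatTorus b → ℂ} (hf : Continuous f) :
    ∫ x, f x ∂vol b = ∫ v in ZSpan.fundamentalDomain b, f (proj b v) := by
  rw [vol, integral_map (continuous_proj b).aemeasurable hf.aestronglyMeasurable]

/-! ### Characters -/

/-- The frequencies of the torus `ℝᵈ / Λ`: the vectors of the dual lattice of `Λ`. -/
abbrev Frequency : Type := dualLattice (Submodule.span ℤ (Set.range b))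

/-- The character of the torus whose lift is the plane wave with wave vector `ξ`. -/
noncomputable def char (ξ : Frequency b) : C(FlatTorus b, ℂ) where
  toFun := Quotient.lift (planeWave (ξ : EuclideanSpace ℝ (Fin d))) fun v w h => by
    rw [← planeWave_sub_right_eq_one_iff, planeWave_eq_one_iff]
    exact mem_dualLattice.1 ξ.2 _ ((proj_eq_proj_iff b).1 (Quotient.sound h))
  continuous_toFun := (contDiff_planeWave _).continuous.quotient_lift _

variable {b}

theorem ext_proj {f g : C(FlatTorus b, ℂ)} (h : ∀ v, f (proj b v) = g (proj b v)) : f = g :=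
  ContinuousMap.ext ((proj_surjective b).forall.2 h)

theorem char_zero : char b 0 = 1 := ext_proj planeWave_zero_left

theorem char_add (ξ η : Frequency b) : char b (ξ + η) = char b ξ * char b η :=
  ext_proj fun v => planeWave_add_left _ _ v

theorem char_neg (ξ : Frequency b) : char b (-ξ) = star (char b ξ) :=
  ext_proj fun v => planeWave_neg_left _ v

theorem norm_char (ξ : Frequency b) (x : FlatTorus b) : ‖char b ξ x‖ = 1 := by
  obtain ⟨v, rfl⟩ := proj_surjective b x
  exact norm_planeWave _ _

theorem isSmooth_char (ξ : Frequency b) : IsSmooth b (char b ξ) := contDiff_planeWave _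

theorem laplaceBeltrami_char (ξ : Frequency b) (x : FlatTorus b) :
    laplaceBeltrami b (char b ξ) x = -(((2 * Real.pi * ‖ξ‖) ^ 2 : ℝ) : ℂ) * char b ξ x := by
  obtain ⟨v, rfl⟩ := proj_surjective b x
  rw [laplaceBeltrami_proj]
  exact laplacian_planeWave _ v

theorem exists_char_ne {x y : FlatTorus b} (hxy : x ≠ y) : ∃ ξ, char b ξ x ≠ char b ξ y := by
  obtain ⟨v, rfl⟩ := proj_surjective b x
  obtain ⟨w, rfl⟩ := proj_surjective b y
  by_contra! h
  refine hxy ((proj_eq_proj_iff b).2 ?_)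
  rw [← dualBasis_dualBasis b, ← dualLattice_span, ← dualLattice_span, mem_dualLattice]
  intro ξ hξ
  simp_rw [real_inner_comm]
  exact planeWave_eq_one_iff.1 (planeWave_sub_right_eq_one_iff.2 (h ⟨ξ, hξ⟩))

theorem integral_char_of_ne_zero {ξ : Frequency b} (hξ : ξ ≠ 0) : ∫ x, char b ξ x ∂vol b = 0 := by
  set η : EuclideanSpace ℝ (Fin d) := ξ.1
  have hη : ‖η‖ ≠ 0 := by simpa [η] using hξ
  have half_wave (v : EuclideanSpace ℝ (Fin d)) :
      planeWave η (v + (2 * ‖η‖ ^ 2)⁻¹ • η) = -planeWave η v := by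
    have : 2 * Real.pi * ((2 * ‖η‖ ^ 2)⁻¹ * ‖η‖ ^ 2) = Real.pi := by field_simp
    rw [planeWave_add_right, planeWave, planeWave, inner_smul_right, real_inner_self_eq_norm_sq,
      Real.fourierChar_apply (_ * _), this, Complex.exp_pi_mul_I, mul_neg_one]
  have hshift : ∫ v in ZSpan.fundamentalDomain b, planeWave η (v + (2 * ‖η‖ ^ 2)⁻¹ • η) =
      ∫ v in ZSpan.fundamentalDomain b, planeWave η v :=
    setIntegral_fundamentalDomain_comp_add_right b volume (periodic_comp_proj b (char b ξ)) _
  simp_rw [half_wave, integral_neg] at hshift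
  rw [integral_vol b (char b ξ).continuous]
  exact self_eq_neg.1 hshift.symm

/-- The star subalgebra of trigonometric polynomials. -/
noncomputable def charSubalgebra (b : Module.Basis (Fin d) ℝ (EuclideanSpace ℝ (Fin d))) :
    StarSubalgebra ℂ C(FlatTorus b, ℂ) where
  toSubalgebra := Algebra.adjoin ℂ (Set.range (char b))
  star_mem' := by
    change Algebra.adjoin ℂ (Set.range (char b)) ≤ star (Algebra.adjoin ℂ (Set.range (char b)))
    refine Algebra.adjoin_le ?_
    rintro _ ⟨ξ, rfl⟩
    exact Algebra.subset_adjoin ⟨-ξ, char_neg ξ⟩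

theorem charSubalgebra_toSubmodule :
    (charSubalgebra b).toSubalgebra.toSubmodule = Submodule.span ℂ (Set.range (char b)) := by
  refine Algebra.adjoin_eq_span_of_subset _ (.trans (fun x => ?_) Submodule.subset_span)
  refine Submonoid.closure_induction (fun _ => id) ⟨0, char_zero⟩ ?_
  rintro _ _ _ _ ⟨ξ, rfl⟩ ⟨η, rfl⟩
  exact ⟨ξ + η, char_add ξ η⟩

theorem span_char_closure_eq_top :
    (Submodule.span ℂ (Set.range (char b))).topologicalClosure = ⊤ := by
  have separatesPoints : (charSubalgebra b).SeparatesPoints := fun x y hxy =>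
    let ⟨ξ, hξ⟩ := exists_char_ne hxy
    ⟨_, ⟨char b ξ, Algebra.subset_adjoin ⟨ξ, rfl⟩, rfl⟩, hξ⟩
  rw [← charSubalgebra_toSubmodule]
  exact congrArg (fun A => Subalgebra.toSubmodule (StarSubalgebra.toSubalgebra A))
    (ContinuousMap.starSubalgebra_topologicalClosure_eq_top_of_separatesPoints _ separatesPoints)

/-! ### The Fourier basis of `L²` -/

/-- The class in `L²` of a continuous function on the torus. -/
noncomputable abbrev toL2 (f : C(FlatTorus b, ℂ)) : Lp ℂ 2 (vol b) :=
  ContinuousMap.toLp 2 (vol b) ℂ f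

theorem inner_toL2 (f g : C(FlatTorus b, ℂ)) :
    ⟪toL2 f, toL2 g⟫_ℂ = ∫ x, g x * star (f x) ∂vol b :=
  ContinuousMap.inner_toLp (vol b) f g

/-- The character with frequency `ξ`, normalized in `L²`. -/
noncomputable def normChar (b : Module.Basis (Fin d) ℝ (EuclideanSpace ℝ (Fin d)))
    (ξ : Frequency b) : C(FlatTorus b, ℂ) :=
  ((√((vol b).real Set.univ))⁻¹ : ℂ) • char b ξ

theorem norm_normChar_sq (ξ : Frequency b) (x : FlatTorus b) :
    ‖normChar b ξ x‖ ^ 2 = ((vol b).real Set.univ)⁻¹ := by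
  simp [normChar, norm_char, Real.sq_sqrt (vol_real_univ_pos b).le]

theorem inner_toL2_char (ξ η : Frequency b) :
    ⟪toL2 (char b ξ), toL2 (char b η)⟫_ℂ =
      if ξ = η then ((vol b).real Set.univ : ℂ) else 0 := by
  have mul_star_char (x : FlatTorus b) : char b η x * star (char b ξ x) = char b (η - ξ) x := by
    rw [sub_eq_add_neg, char_add, char_neg]
    rfl
  simp_rw [inner_toL2, mul_star_char]
  split_ifs with h
  · simp [h, char_zero]
  · exact integral_char_of_ne_zero (sub_ne_zero.2 (Ne.symm h))

theorem orthonormal_normChar : Orthonormal ℂ fun ξ : Frequency b => toL2 (normChar b ξ) := by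
  have hvol := vol_real_univ_pos b
  have hsqrt : ((√((vol b).real Set.univ))⁻¹ : ℂ) * (((√((vol b).real Set.univ))⁻¹ : ℂ) *
      (vol b).real Set.univ) = 1 := by
    norm_cast
    rw [← mul_assoc, ← mul_inv, Real.mul_self_sqrt hvol.le, inv_mul_cancel₀ hvol.ne']
  rw [orthonormal_iff_ite]
  intro ξ η
  simp only [normChar, toL2, map_smul, inner_smul_left, inner_smul_right, inner_toL2_char,
    map_inv₀, Complex.conj_ofReal, mul_ite, hsqrt, mul_zero]

open scoped Pointwise in
theorem span_normChar_closure_eq_top :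
    (Submodule.span ℂ
      (Set.range fun ξ : Frequency b => toL2 (normChar b ξ))).topologicalClosure = ⊤ := by
  have hunit : IsUnit ((√((vol b).real Set.univ))⁻¹ : ℂ) := by
    simpa [isUnit_iff_ne_zero] using (Real.sqrt_pos.2 (vol_real_univ_pos b)).ne'
  have hrange : (Set.range fun ξ : Frequency b => toL2 (normChar b ξ)) =
      ContinuousMap.toLp 2 (vol b) ℂ '' (((√((vol b).real Set.univ))⁻¹ : ℂ) •
        Set.range (char b)) := by
    rw [Set.smul_set_range, ← Set.range_comp]
    rfl
  rw [hrange, ← ContinuousLinearMap.coe_coe, ← Submodule.map_span,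
    Submodule.span_smul_eq_of_isUnit _ _ hunit]
  exact (ContinuousMap.toLp_denseRange ℂ (vol b) ℂ (by simp)).topologicalClosure_map_submodule
    span_char_closure_eq_top

/-- The Hilbert basis of `L²` of the torus consisting of the normalized characters. -/
noncomputable def fourierBasis (b : Module.Basis (Fin d) ℝ (EuclideanSpace ℝ (Fin d))) :
    HilbertBasis (Frequency b) ℂ (Lp ℂ 2 (vol b)) :=
  HilbertBasis.mk orthonormal_normChar span_normChar_closure_eq_top.ge

theorem fourierBasis_apply (ξ : Frequency b) : fourierBasis b ξ = toL2 (normChar b ξ) := by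
  simp [fourierBasis]

end FlatTorus

/-! ### The local Weyl counting function -/

namespace FlatTorus

variable {d : ℕ} {b : Module.Basis (Fin d) ℝ (EuclideanSpace ℝ (Fin d))}

theorem integral_mul_eq_zero_of_eigenvalue_ne {f g : C(FlatTorus b, ℂ)} (hf : IsSmooth b f)
    (hg : IsSmooth b g) {μ ν : ℂ} (hμν : μ ≠ ν) (hμ : ∀ x, laplaceBeltrami b f x = μ * f x)
    (hν : ∀ x, laplaceBeltrami b g x = ν * g x) : ∫ x, f x * g x ∂vol b = 0 := by
  have green := setIntegral_fundamentalDomain_laplacian_mul b volume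
    (hf.of_le (by norm_cast)) (hg.of_le (by norm_cast))
    (periodic_comp_proj b f) (periodic_comp_proj b g)
  simp_rw [← laplaceBeltrami_proj, hμ, hν, Function.comp_apply, mul_left_comm _ ν, mul_assoc,
    integral_const_mul] at green
  exact (integral_vol b (f.continuous.mul g.continuous)).trans
    ((mul_eq_mul_right_iff.1 green).resolve_left hμν)

/-- The `j`-th eigenfunction as a continuous function. -/
noncomputable def EigenSystem.toContinuousMap (S : EigenSystem b) (j : ℕ) :
    C(FlatTorus b, ℂ) where
  toFun := S.e j
  continuous_toFun := isQuotientMap_quotient_mk'.continuous_iff.2 (S.smooth j).continuous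

theorem EigenSystem.basis_eq_toL2 (S : EigenSystem b) (j : ℕ) :
    S.basis j = toL2 (S.toContinuousMap j) :=
  Lp.ext ((S.basis_ae j).trans
    (ContinuousMap.coeFn_toLp (𝕜 := ℂ) (vol b) (S.toContinuousMap j)).symm)

theorem EigenSystem.laplaceBeltrami_e (S : EigenSystem b) (j : ℕ) (x : FlatTorus b) :
    laplaceBeltrami b (S.e j) x = -((S.freq j ^ 2 : ℝ) : ℂ) * S.e j x := by
  rw [neg_mul, ← S.eigen, neg_neg]

theorem EigenSystem.inner_fourierBasis_eq_zero (S : EigenSystem b) {j : ℕ} {ξ : Frequency b}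
    (hξ : 2 * Real.pi * ‖ξ‖ ≠ S.freq j) : ⟪fourierBasis b ξ, S.basis j⟫_ℂ = 0 := by
  have eigenvalue_ne : -((S.freq j ^ 2 : ℝ) : ℂ) ≠ -(((2 * Real.pi * ‖-ξ‖) ^ 2 : ℝ) : ℂ) := by
    rw [norm_neg, ne_eq, neg_inj, Complex.ofReal_inj,
      sq_eq_sq₀ (S.freq_nonneg j) (by positivity)]
    exact hξ.symm
  have orthogonal : ∫ x, S.e j x * char b (-ξ) x ∂vol b = 0 :=
    integral_mul_eq_zero_of_eigenvalue_ne (f := S.toContinuousMap j) (S.smooth j)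
      (isSmooth_char (-ξ)) eigenvalue_ne (S.laplaceBeltrami_e j) (laplaceBeltrami_char (-ξ))
  rw [char_neg] at orthogonal
  rw [fourierBasis_apply, S.basis_eq_toL2, normChar, toL2, map_smul, inner_smul_left, inner_toL2]
  exact mul_eq_zero_of_right _ orthogonal

theorem EigenSystem.e_eq_sum (S : EigenSystem b) {j : ℕ} {s : Finset (Frequency b)}
    (hs : ∀ ξ : Frequency b, 2 * Real.pi * ‖ξ‖ = S.freq j → ξ ∈ s) (x : FlatTorus b) :
    S.e j x = ∑ ξ ∈ s, ⟪fourierBasis b ξ, S.basis j⟫_ℂ * normChar b ξ x := by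
  have basis_eq_sum : S.basis j = ∑ ξ ∈ s, ⟪fourierBasis b ξ, S.basis j⟫_ℂ • fourierBasis b ξ := by
    refine ((fourierBasis b).hasSum_repr (S.basis j)).unique ?_
    simp_rw [HilbertBasis.repr_apply_apply]
    refine hasSum_sum_of_ne_finset_zero fun ξ hξ => ?_
    rw [S.inner_fourierBasis_eq_zero (mt (hs ξ) hξ), zero_smul]
  have toL2_eq : toL2 (S.toContinuousMap j) =
      toL2 (∑ ξ ∈ s, ⟪fourierBasis b ξ, S.basis j⟫_ℂ • normChar b ξ) := by
    simp only [← S.basis_eq_toL2, map_sum, map_smul, ← fourierBasis_apply]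
    exact basis_eq_sum
  have e_eq := DFunLike.congr_fun (ContinuousMap.toLp_injective (𝕜 := ℂ) (vol b) toL2_eq) x
  rwa [ContinuousMap.sum_apply] at e_eq

variable (b) in
theorem finite_frequency_le (t : ℝ) : {ξ : Frequency b | 2 * Real.pi * ‖ξ‖ ≤ t}.Finite :=
  (finite_norm_le_dualLattice b (t / (2 * Real.pi))).subset fun _ h =>
    (le_div_iff₀' Real.two_pi_pos).2 h

variable (b) in
/-- The reproducing kernel at `x` of the sum of the eigenspaces with frequency at most `t`. -/
noncomputable def spectralKernel (x : FlatTorus b) (t : ℝ) : Lp ℂ 2 (vol b) :=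
  ∑ ξ ∈ (finite_frequency_le b t).toFinset, star (normChar b ξ x) • fourierBasis b ξ

theorem norm_spectralKernel_sq (x : FlatTorus b) (t : ℝ) : ‖spectralKernel b x t‖ ^ 2 =
    {ξ : Frequency b | 2 * Real.pi * ‖ξ‖ ≤ t}.ncard * ((vol b).real Set.univ)⁻¹ := by
  rw [← Complex.ofReal_inj, Complex.ofReal_pow, ← Complex.coe_algebraMap,
    ← inner_self_eq_norm_sq_to_K, spectralKernel, (fourierBasis b).orthonormal.inner_sum,
    Set.ncard_eq_toFinset_card _ (finite_frequency_le b t)]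
  simp_rw [RCLike.conj_mul, norm_star, ← RCLike.ofReal_pow, norm_normChar_sq, Finset.sum_const]
  simp

theorem EigenSystem.inner_spectralKernel (S : EigenSystem b) (x : FlatTorus b) (t : ℝ) (j : ℕ) :
    ⟪spectralKernel b x t, S.basis j⟫_ℂ = if S.freq j ≤ t then S.e j x else 0 := by
  simp only [spectralKernel, sum_inner, inner_smul_left, RCLike.star_def, RCLike.conj_conj,
    mul_comm (normChar b _ x)]
  split_ifs with hj
  · exact (S.e_eq_sum (fun ξ hξ => by simpa [← hξ] using hj) x).symm
  · refine Finset.sum_eq_zero fun ξ hξ => ?_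
    have hξ : 2 * Real.pi * ‖ξ‖ ≤ t := by simpa using hξ
    rw [S.inner_fourierBasis_eq_zero fun h => hj (h ▸ hξ), zero_mul]

/-- Parseval's identity for the reproducing kernel, in the eigenbasis and in the Fourier basis. -/
theorem localWeyl_eq (S : EigenSystem b) (x : FlatTorus b) (t : ℝ) :
    localWeyl S x t = ENNReal.ofReal
      ({ξ : Frequency b | 2 * Real.pi * ‖ξ‖ ≤ t}.ncard * ((vol b).real Set.univ)⁻¹) := by
  have parseval : HasSum (fun j => ‖⟪spectralKernel b x t, S.basis j⟫_ℂ‖ ^ 2)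
      (‖spectralKernel b x t‖ ^ 2) := by
    have h := S.basis.hasSum_inner_mul_inner (spectralKernel b x t) (spectralKernel b x t)
    simp_rw [← inner_conj_symm (S.basis _), RCLike.mul_conj, inner_self_eq_norm_sq_to_K] at h
    exact_mod_cast h
  rw [← norm_spectralKernel_sq x, ← parseval.tsum_eq,
    ENNReal.ofReal_tsum_of_nonneg (fun j => by positivity) parseval.summable]
  refine (tsum_subtype {j | S.freq j ≤ t} (fun j => ‖S.e j x‖ₑ ^ 2)).trans (tsum_congr fun j => ?_)
  simp only [S.inner_spectralKernel, Set.indicator_apply, Set.mem_ofPred_eq]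
  split_ifs
  · rw [ENNReal.ofReal_pow (norm_nonneg _), ofReal_norm]
  · simp

instance [NeZero d] : Infinite (Frequency b) := by
  have mem_dual : dualBasis b 0 ∈ dualLattice (Submodule.span ℤ (Set.range b)) := by
    rw [dualLattice_span]
    exact Submodule.subset_span ⟨0, rfl⟩
  refine .of_injective (fun k : ℤ => k • (⟨_, mem_dual⟩ : Frequency b)) fun k m h => ?_
  have smul_eq : (k : ℝ) • dualBasis b 0 = (m : ℝ) • dualBasis b 0 := by
    rw [Int.cast_smul_eq_zsmul, Int.cast_smul_eq_zsmul]
    exact congrArg Subtype.val h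
  exact Int.cast_injective (smul_left_injective ℝ ((dualBasis b).ne_zero 0) smul_eq)

theorem isSmooth_normChar (ξ : Frequency b) : IsSmooth b (normChar b ξ) :=
  contDiff_const.smul (isSmooth_char ξ)

theorem laplaceBeltrami_normChar (ξ : Frequency b) (x : FlatTorus b) :
    laplaceBeltrami b (normChar b ξ) x =
      -(((2 * Real.pi * ‖ξ‖) ^ 2 : ℝ) : ℂ) * normChar b ξ x := by
  have laplacian_smul (v : EuclideanSpace ℝ (Fin d)) :
      Laplacian.laplacian (normChar b ξ ∘ proj b) v =
        ((√((vol b).real Set.univ))⁻¹ : ℂ) * Laplacian.laplacian (char b ξ ∘ proj b) v :=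
    InnerProductSpace.laplacian_smul _ ((isSmooth_char ξ).contDiffAt.of_le (by norm_cast))
  rw [laplaceBeltrami, laplacian_smul, ← laplaceBeltrami, laplaceBeltrami_char, mul_left_comm]
  rfl

variable (b) in
theorem nonempty_eigenSystem [NeZero d] : Nonempty (EigenSystem b) := by
  obtain ⟨σ, hσ⟩ := exists_equiv_nat_monotone (fun ξ : Frequency b => 2 * Real.pi * ‖ξ‖)
    (finite_frequency_le b)
  have dense_span : (Submodule.span ℂ (Set.range (fourierBasis b ∘ σ))).topologicalClosure = ⊤ := by
    rw [σ.surjective.range_comp]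
    exact (fourierBasis b).dense_span
  refine ⟨{ freq := fun j => 2 * Real.pi * ‖σ j‖
            e := fun j => normChar b (σ j)
            freq_nonneg := fun j => by positivity
            freq_mono := hσ
            smooth := fun j => isSmooth_normChar (σ j)
            eigen := fun j x => by rw [laplaceBeltrami_normChar, neg_mul, neg_neg]
            basis := HilbertBasis.mk ((fourierBasis b).orthonormal.comp σ σ.injective)
              dense_span.ge
            basis_ae := fun j => ?_ }⟩
  rw [HilbertBasis.coe_mk, Function.comp_apply, fourierBasis_apply]
  exact ContinuousMap.coeFn_toLp (𝕜 := ℂ) (vol b) _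

theorem exists_localWeyl_eq {d' : ℕ} {b' : Module.Basis (Fin d') ℝ (EuclideanSpace ℝ (Fin d'))}
    (hvol : (vol b).real Set.univ = (vol b').real Set.univ)
    (e : Frequency b ≃ Frequency b') (he : ∀ ξ, ‖e ξ‖ = ‖ξ‖) :
    ∃ f : ℝ → ℝ≥0, (∀ (S : EigenSystem b) (x : FlatTorus b) (t : ℝ), localWeyl S x t = f t) ∧
      ∀ (S : EigenSystem b') (x : FlatTorus b') (t : ℝ), localWeyl S x t = f t := by
  refine ⟨fun t => Real.toNNReal ({ξ : Frequency b | 2 * Real.pi * ‖ξ‖ ≤ t}.ncard *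
    ((vol b).real Set.univ)⁻¹), fun S x t => localWeyl_eq S x t, fun S x t => ?_⟩
  have image_eq : e '' {ξ | 2 * Real.pi * ‖ξ‖ ≤ t} = {ξ | 2 * Real.pi * ‖ξ‖ ≤ t} := by
    ext ξ
    simp [e.image_eq_preimage_symm, ← he]
  rw [localWeyl_eq, ← image_eq, Set.ncard_image_of_injective _ e.injective, ← hvol]
  rfl

end FlatTorus

/-! ### Isometries of flat tori -/

theorem exists_linearIsometry_eqOn_ball {E F : Type*} [NormedAddCommGroup E]
    [InnerProductSpace ℝ E] [FiniteDimensional ℝ E] [NormedAddCommGroup F] [InnerProductSpace ℝ F]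
    {r : ℝ} (hr : 0 < r) {ψ : E → F}
    (hψ : ∀ v w, ‖v‖ < r → ‖w‖ < r → ⟪ψ v, ψ w⟫_ℝ = ⟪v, w⟫_ℝ) :
    ∃ A : E →ₗᵢ[ℝ] F, ∀ v, ‖v‖ < r → ψ v = A v := by
  let u := stdOrthonormalBasis ℝ E
  let L : E →ₗ[ℝ] F := u.toBasis.constr ℝ fun i => (r / 2)⁻¹ • ψ ((r / 2) • u i)
  have norm_lt (i) : ‖(r / 2) • u i‖ < r := by
    rw [norm_smul, u.norm_eq_one, Real.norm_of_nonneg (by positivity)]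
    linarith
  have L_apply (i) : L (u i) = (r / 2)⁻¹ • ψ ((r / 2) • u i) := by
    rw [← u.coe_toBasis, u.toBasis.constr_basis, u.coe_toBasis]
  have inner_L_left {v : E} (hv : ‖v‖ < r) (w : E) : ⟪L w, ψ v⟫_ℝ = ⟪w, v⟫_ℝ := by
    suffices (innerₗ F).flip (ψ v) ∘ₗ L = (innerₗ E).flip v from LinearMap.congr_fun this w
    refine u.toBasis.ext fun i => ?_
    simp only [LinearMap.comp_apply, LinearMap.flip_apply, innerₗ_apply_apply, u.coe_toBasis,
      L_apply]
    rw [real_inner_smul_left, hψ _ _ (norm_lt i) hv, real_inner_smul_left,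
      inv_mul_cancel_left₀ (by positivity)]
  have inner_L (v w : E) : ⟪L v, L w⟫_ℝ = ⟪v, w⟫_ℝ := by
    suffices innerₗ F (L v) ∘ₗ L = innerₗ E v from LinearMap.congr_fun this w
    refine u.toBasis.ext fun i => ?_
    simp only [LinearMap.comp_apply, innerₗ_apply_apply, u.coe_toBasis, L_apply]
    rw [real_inner_smul_right, inner_L_left (norm_lt i), real_inner_smul_right,
      inv_mul_cancel_left₀ (by positivity)]
  refine ⟨L.isometryOfInner inner_L, fun v hv => ?_⟩
  rw [LinearMap.coe_isometryOfInner, ← sub_eq_zero, ← inner_self_eq_zero (𝕜 := ℝ),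
    real_inner_sub_sub_self, hψ v v hv hv, real_inner_comm (L v), inner_L_left hv, inner_L]
  ring

section

variable {E F : Type*} [NormedAddCommGroup E] [NormedSpace ℝ E]

theorem linearIsometry_eq_of_eqOn_ball [NormedAddCommGroup F] [NormedSpace ℝ F]
    {A B : E →ₗᵢ[ℝ] F} {r : ℝ} (hr : 0 < r) (h : ∀ v, ‖v‖ < r → A v = B v) : A = B := by
  have eventuallyEq : A.toContinuousLinearMap =ᶠ[nhds 0] B.toContinuousLinearMap :=
    Filter.mem_of_superset (Metric.ball_mem_nhds 0 hr) fun v hv => h v (mem_ball_zero_iff.1 hv)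
  exact LinearIsometry.toContinuousLinearMap_injective (A.toContinuousLinearMap.hasFDerivAt.unique
    (B.toContinuousLinearMap.hasFDerivAt.congr_of_eventuallyEq eventuallyEq))

theorem apply_eq_of_add_eq_of_norm_lt {f : E → F} {r : ℝ} (hr : 0 < r)
    (hf : ∀ v w, ‖w‖ < r → f (v + w) = f v) (v w : E) : f v = f w := by
  have locallyConstant : IsLocallyConstant f := by
    refine (IsLocallyConstant.iff_eventually_eq f).2 fun v => ?_
    filter_upwards [Metric.ball_mem_nhds v hr] with w hw
    rw [← hf v (w - v) (mem_ball_iff_norm.1 hw), add_sub_cancel]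
  exact locallyConstant.apply_eq_of_preconnectedSpace v w

end

namespace FlatTorus

variable {d d' : ℕ} {b : Module.Basis (Fin d) ℝ (EuclideanSpace ℝ (Fin d))}
  {b' : Module.Basis (Fin d') ℝ (EuclideanSpace ℝ (Fin d'))}

theorem proj_add (v w : EuclideanSpace ℝ (Fin d)) : proj b (v + w) = proj b v + proj b w := rfl

theorem proj_sub (v w : EuclideanSpace ℝ (Fin d)) : proj b (v - w) = proj b v - proj b w := rfl

variable (b) in
theorem exists_norm_proj_eq : ∃ r > 0, ∀ v, ‖v‖ < r → ‖proj b v‖ = ‖v‖ := by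
  have : DiscreteTopology (Submodule.span ℤ (Set.range b) : Set (EuclideanSpace ℝ (Fin d))) :=
    inferInstanceAs (DiscreteTopology (Submodule.span ℤ (Set.range b)))
  obtain ⟨r, hr, ball_inter⟩ := Metric.exists_ball_inter_eq_singleton_of_mem_discrete
    (isDiscrete_iff_discreteTopology.2 this) (zero_mem (Submodule.span ℤ (Set.range b)))
  refine ⟨r / 2, half_pos hr, fun v hv => QuotientAddGroup.norm_mk_le_norm.antisymm ?_⟩
  refine QuotientAddGroup.le_norm_iff.2 fun w hw => ?_
  by_contra! hlt
  have mem_ball : w - v ∈ Metric.ball 0 r := by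
    rw [mem_ball_zero_iff]
    linarith [norm_sub_le w v]
  have sub_eq : w - v ∈ ({0} : Set _) := ball_inter ▸ ⟨mem_ball, (proj_eq_proj_iff b).1 hw⟩
  exact hlt.ne (congrArg norm (sub_eq_zero.1 sub_eq))

theorem eq_of_proj_eq {r : ℝ} (hb : ∀ v, ‖v‖ < r → ‖proj b v‖ = ‖v‖)
    {v w : EuclideanSpace ℝ (Fin d)} (hvw : ‖v - w‖ < r) (h : proj b v = proj b w) : v = w := by
  rw [← sub_eq_zero, ← norm_eq_zero, ← hb _ hvw, proj_sub, h, sub_self, norm_zero]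

section

variable {r : ℝ} (hb : ∀ v, ‖v‖ < r → ‖proj b v‖ = ‖v‖)
  (hb' : ∀ v, ‖v‖ < r → ‖proj b' v‖ = ‖v‖) {φ : FlatTorus b → FlatTorus b'} (hφ : Isometry φ)

include hb hb' hφ

theorem exists_linearIsometry_near (hr : 0 < r) (x : FlatTorus b) :
    ∃ A : EuclideanSpace ℝ (Fin d) →ₗᵢ[ℝ] EuclideanSpace ℝ (Fin d'),
      ∀ v, ‖v‖ < r / 2 → φ (x + proj b v) = φ x + proj b' (A v) := by
  have exists_lift (v : EuclideanSpace ℝ (Fin d)) (hv : ‖v‖ < r) :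
      ∃ w, proj b' w = φ (x + proj b v) - φ x ∧ ‖w‖ = ‖v‖ := by
    have norm_eq : ‖φ (x + proj b v) - φ x‖ = ‖v‖ := by
      rw [← dist_eq_norm, hφ.dist_eq, dist_eq_norm, add_sub_cancel_left, hb v hv]
    obtain ⟨w, hw, hlt⟩ := QuotientAddGroup.norm_lt_iff.1 (norm_eq.trans_lt hv)
    exact ⟨w, hw, by rw [← hb' w hlt, ← norm_eq, ← hw]; rfl⟩
  choose! ψ hψ norm_ψ using exists_lift
  have norm_ψ_sub {v w} (hv : ‖v‖ < r / 2) (hw : ‖w‖ < r / 2) : ‖ψ v - ψ w‖ = ‖v - w‖ := by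
    have hvr : ‖v‖ < r := by linarith
    have hwr : ‖w‖ < r := by linarith
    have hψvw : ‖ψ v - ψ w‖ < r := by
      linarith [norm_sub_le (ψ v) (ψ w), norm_ψ v hvr, norm_ψ w hwr]
    have hvw : ‖v - w‖ < r := by linarith [norm_sub_le v w]
    rw [← hb' _ hψvw, ← hb _ hvw, proj_sub, hψ v hvr, hψ w hwr, sub_sub_sub_cancel_right,
      ← dist_eq_norm, hφ.dist_eq, dist_eq_norm, add_sub_add_left_eq_sub, proj_sub]
  obtain ⟨A, hA⟩ := exists_linearIsometry_eqOn_ball (half_pos hr) (ψ := ψ) fun v w hv hw => by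
    simp only [real_inner_eq_norm_mul_self_add_norm_mul_self_sub_norm_sub_mul_self_div_two,
      norm_ψ_sub hv hw, norm_ψ v (by linarith), norm_ψ w (by linarith)]
  refine ⟨A, fun v hv => ?_⟩
  rw [← hA v hv, hψ v (by linarith), add_sub_cancel]

theorem exists_linearIsometry_everywhere (hr : 0 < r) :
    ∃ A : EuclideanSpace ℝ (Fin d) →ₗᵢ[ℝ] EuclideanSpace ℝ (Fin d'),
      ∀ x v, ‖v‖ < r / 4 → φ (x + proj b v) = φ x + proj b' (A v) := by
  choose A hA using exists_linearIsometry_near hb hb' hφ hr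
  have A_add (x : FlatTorus b) {w} (hw : ‖w‖ < r / 4) : A (x + proj b w) = A x := by
    refine linearIsometry_eq_of_eqOn_ball (by positivity : 0 < r / 4) fun v hv => ?_
    have proj_eq : proj b' (A (x + proj b w) v) = proj b' (A x v) := by
      have h := hA x (w + v) (by linarith [norm_add_le w v])
      rw [proj_add, ← add_assoc, hA (x + proj b w) v (by linarith), hA x w (by linarith),
        map_add, proj_add, add_assoc] at h
      exact add_left_cancel (add_left_cancel h)
    refine eq_of_proj_eq hb' ?_ proj_eq
    linarith [norm_sub_le (A (x + proj b w) v) (A x v), (A x).norm_map v,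
      (A (x + proj b w)).norm_map v]
  have A_proj_const (v) : A (proj b v) = A (proj b 0) :=
    apply_eq_of_add_eq_of_norm_lt (f := fun v => A (proj b v)) (by positivity : 0 < r / 4)
      (fun v w hw => A_add (proj b v) hw) v 0
  refine ⟨A (proj b 0), fun x v hv => ?_⟩
  obtain ⟨w, rfl⟩ := proj_surjective b x
  rw [hA _ v (by linarith), A_proj_const]

end

theorem exists_linearIsometry_lift {φ : FlatTorus b → FlatTorus b'} (hφ : Isometry φ) :
    ∃ A : EuclideanSpace ℝ (Fin d) →ₗᵢ[ℝ] EuclideanSpace ℝ (Fin d'),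
      ∀ v, φ (proj b v) = φ (proj b 0) + proj b' (A v) := by
  obtain ⟨r₁, hr₁, hb⟩ := exists_norm_proj_eq b
  obtain ⟨r₂, hr₂, hb'⟩ := exists_norm_proj_eq b'
  have hr := lt_min hr₁ hr₂
  obtain ⟨A, hA⟩ := exists_linearIsometry_everywhere (fun v hv => hb v (lt_min_iff.1 hv).1)
    (fun v hv => hb' v (lt_min_iff.1 hv).2) hφ hr
  refine ⟨A, fun v => ?_⟩
  have const := apply_eq_of_add_eq_of_norm_lt (f := fun v => φ (proj b v) - proj b' (A v))
    (by positivity : 0 < min r₁ r₂ / 4) (fun v w hw => by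
      simp only [map_add, proj_add, hA _ w hw, add_sub_add_right_eq_sub]) v 0
  rw [← sub_eq_iff_eq_add, const, map_zero]
  exact sub_zero _

theorem exists_linearIsometry_map_dualLattice
    {b b' : Module.Basis (Fin d) ℝ (EuclideanSpace ℝ (Fin d))} {φ : FlatTorus b → FlatTorus b'}
    (hφ : Isometry φ) :
    ∃ B : EuclideanSpace ℝ (Fin d) →ₗᵢ[ℝ] EuclideanSpace ℝ (Fin d),
      ∀ ξ ∈ dualLattice (Submodule.span ℤ (Set.range b')),
        B ξ ∈ dualLattice (Submodule.span ℤ (Set.range b)) := by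
  obtain ⟨A, hA⟩ := exists_linearIsometry_lift hφ
  have A_mem (l) (hl : l ∈ Submodule.span ℤ (Set.range b)) :
      A l ∈ Submodule.span ℤ (Set.range b') := by
    have proj_eq : proj b l = proj b 0 := (proj_eq_proj_iff b).2 (by rwa [sub_zero])
    have h := hA l
    rw [proj_eq, left_eq_add] at h
    simpa using (proj_eq_proj_iff b' (w := 0)).1 h
  let B := A.toLinearIsometryEquiv rfl
  refine ⟨B.symm.toLinearIsometry, fun ξ hξ => mem_dualLattice.2 fun l hl => ?_⟩
  rw [← B.inner_map_map]
  simpa [B] using mem_dualLattice.1 hξ _ (A_mem l hl)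

end FlatTorus

/-! ### Integral lattices with diagonal forms -/

section WeightedLattice

open scoped Matrix

variable {ι κ : Type*} [Fintype ι] [Fintype κ]

/-- The lattice in `ℤ^ι` spanned by the rows of `M`. -/
def rowLattice (M : Matrix ι ι ℤ) : Submodule ℤ (ι → ℤ) :=
  LinearMap.range M.vecMulLinear

theorem mem_rowLattice {M : Matrix ι ι ℤ} {x : ι → ℤ} : x ∈ rowLattice M ↔ ∃ n, n ᵥ* M = x :=
  Iff.rfl

theorem mem_rowLattice_iff_dvd_mulVec [DecidableEq ι] {M : Matrix ι ι ℤ} {m : ℤ} (hm : m ≠ 0)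
    (hM : M * Mᵀ = m • (1 : Matrix ι ι ℤ)) {x : ι → ℤ} :
    x ∈ rowLattice M ↔ ∀ i, m ∣ (M *ᵥ x) i := by
  have det_ne : M.det ≠ 0 := fun h => by
    have := congrArg Matrix.det hM
    rw [Matrix.det_mul, h, zero_mul, Matrix.det_smul, Matrix.det_one, mul_one] at this
    exact pow_ne_zero _ hm this.symm
  have mulVec_vecMul (n : ι → ℤ) : M *ᵥ (n ᵥ* M) = m • n := by
    rw [← Matrix.mulVec_transpose, Matrix.mulVec_mulVec, hM, Matrix.smul_mulVec, Matrix.one_mulVec]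
  rw [mem_rowLattice]
  constructor
  · rintro ⟨n, rfl⟩ i
    exact mulVec_vecMul n ▸ ⟨n i, rfl⟩
  · intro h
    choose n hn using h
    refine ⟨n, Matrix.mulVec_injective_of_det_ne_zero det_ne ?_⟩
    rw [mulVec_vecMul]
    exact (funext hn).symm

theorem mem_rowLattice_fromBlocks [DecidableEq κ] {M : Matrix ι ι ℤ} {x : ι ⊕ κ → ℤ} :
    x ∈ rowLattice (Matrix.fromBlocks M 0 0 (1 : Matrix κ κ ℤ)) ↔ x ∘ Sum.inl ∈ rowLattice M := by
  simp only [mem_rowLattice, Matrix.vecMul_fromBlocks, Matrix.vecMul_zero, Matrix.vecMul_one,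
    add_zero, zero_add]
  constructor
  · rintro ⟨n, rfl⟩
    exact ⟨n ∘ Sum.inl, rfl⟩
  · rintro ⟨n, hn⟩
    exact ⟨Sum.elim n (x ∘ Sum.inr), by simp [hn]⟩

/-- The bilinear form on `ℤ^ι` with Gram matrix `diag a`. -/
def diagForm (a : ι → ℕ) (x y : ι → ℤ) : ℤ := ∑ i, a i * (x i * y i)

variable {E : Type*} [NormedAddCommGroup E] [InnerProductSpace ℝ E]

/-- The embedding of `ℤ^ι`, with the form `diag a`, into an inner product space. -/
noncomputable def weightedVec (b₀ : OrthonormalBasis ι ℝ E) (a : ι → ℕ) : (ι → ℤ) →ₗ[ℤ] E where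
  toFun x := ∑ i, (√(a i) * x i) • b₀ i
  map_add' x y := by
    simp only [Pi.add_apply, Int.cast_add, mul_add, add_smul, Finset.sum_add_distrib]
  map_smul' m x := by
    simp only [Pi.smul_apply, smul_eq_mul, Int.cast_mul, eq_intCast, Int.cast_id, Finset.smul_sum,
      ← Int.cast_smul_eq_zsmul ℝ m, smul_smul, mul_left_comm]

variable (b₀ : OrthonormalBasis ι ℝ E) {a : ι → ℕ}

theorem repr_weightedVec (x : ι → ℤ) (i : ι) : b₀.repr (weightedVec b₀ a x) i = √(a i) * x i := by
  rw [show weightedVec b₀ a x = b₀.repr.symm (.toLp 2 fun i => √(a i) * x i) from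
    b₀.sum_repr_symm (.toLp 2 fun i => √(a i) * x i), LinearIsometryEquiv.apply_symm_apply]

theorem inner_weightedVec (x y : ι → ℤ) :
    ⟪weightedVec b₀ a x, weightedVec b₀ a y⟫_ℝ = diagForm a x y := by
  rw [← b₀.repr.inner_map_map, PiLp.inner_apply, diagForm, Int.cast_sum]
  refine Finset.sum_congr rfl fun i _ => ?_
  rw [repr_weightedVec, repr_weightedVec, RCLike.inner_apply, conj_trivial, mul_mul_mul_comm,
    Real.mul_self_sqrt (Nat.cast_nonneg _)]
  push_cast
  ring

theorem norm_weightedVec_eq {x y : ι → ℤ} (h : diagForm a x x = diagForm a y y) :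
    ‖weightedVec b₀ a x‖ = ‖weightedVec b₀ a y‖ := by
  rw [norm_eq_sqrt_real_inner, norm_eq_sqrt_real_inner, inner_weightedVec, inner_weightedVec, h]

theorem weightedVec_injective (ha : ∀ i, a i ≠ 0) : Function.Injective (weightedVec b₀ a) := by
  intro x y h
  funext i
  simpa [repr_weightedVec, ha i] using congrArg (b₀.repr · i) h

/-- The lattice spanned by the rows of `M`, with the form `diag a`, in an inner product space. -/
noncomputable def weightedLattice (a : ι → ℕ) (M : Matrix ι ι ℤ) : Submodule ℤ E :=
  (rowLattice M).map (weightedVec b₀ a)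

theorem exists_equiv_weightedLattice (ha : ∀ i, a i ≠ 0) {M M' : Matrix ι ι ℤ}
    (F : Equiv.Perm (ι → ℤ)) (hF : ∀ x, x ∈ rowLattice M ↔ F x ∈ rowLattice M')
    (hsq : ∀ x i, F x i ^ 2 = x i ^ 2) :
    ∃ e : weightedLattice b₀ a M ≃ weightedLattice b₀ a M', ∀ ξ, ‖e ξ‖ = ‖ξ‖ := by
  have norm_eq (x) : ‖weightedVec b₀ a (F x)‖ = ‖weightedVec b₀ a x‖ := by
    refine norm_weightedVec_eq b₀ ?_
    simp only [diagForm, ← sq, hsq]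
  let param (M : Matrix ι ι ℤ) :=
    Submodule.equivMapOfInjective _ (weightedVec_injective b₀ ha) (rowLattice M)
  refine ⟨(param M).symm.toEquiv.trans ((F.subtypeEquiv hF).trans (param M').toEquiv), fun ξ => ?_⟩
  obtain ⟨x, rfl⟩ := (param M).surjective ξ
  change ‖weightedVec b₀ a (F ((param M).symm (param M x)))‖ = ‖weightedVec b₀ a x‖
  rw [LinearEquiv.symm_apply_apply, norm_eq]

variable [DecidableEq ι]

theorem det_weightedVec (M : Matrix ι ι ℤ) :
    b₀.toBasis.det (fun i => weightedVec b₀ a (M i)) = M.det * ∏ i, √(a i) := by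
  have toMatrix_eq : b₀.toBasis.toMatrix (fun i => weightedVec b₀ a (M i)) =
      Matrix.diagonal (fun i => √(a i)) * (M.map (Int.cast : ℤ → ℝ))ᵀ := by
    ext i j
    rw [Module.Basis.toMatrix_apply, b₀.coe_toBasis_repr_apply, repr_weightedVec,
      Matrix.diagonal_mul]
    rfl
  rw [Module.Basis.det_apply, toMatrix_eq, Matrix.det_mul, Matrix.det_diagonal,
    Matrix.det_transpose, mul_comm, Int.cast_det]

theorem exists_basis_weightedLattice (ha : ∀ i, a i ≠ 0) {M : Matrix ι ι ℤ} (hM : M.det ≠ 0) :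
    ∃ c : Module.Basis ι ℝ E, Submodule.span ℤ (Set.range c) = weightedLattice b₀ a M ∧
      b₀.toBasis.det c = M.det * ∏ i, √(a i) := by
  have det_ne : (M.det : ℝ) * ∏ i, √(a i : ℝ) ≠ 0 :=
    mul_ne_zero (Int.cast_ne_zero.2 hM) (Finset.prod_ne_zero_iff.2 fun i _ => by simp [ha i])
  obtain ⟨li, span_eq⟩ := (Module.Basis.is_basis_iff_det b₀.toBasis).2
    (det_weightedVec b₀ (a := a) M ▸ det_ne.isUnit)
  refine ⟨.mk li span_eq.ge, ?_, by rw [Module.Basis.coe_mk, det_weightedVec]⟩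
  rw [Module.Basis.coe_mk, weightedLattice, rowLattice, range_vecMulLinear,
    Submodule.map_span, ← Set.range_comp]
  rfl

theorem det_dualBasis_mul_det (c : Module.Basis ι ℝ E) :
    b₀.toBasis.det (dualBasis c) * b₀.toBasis.det c = 1 := by
  have transpose_mul : (b₀.toBasis.toMatrix (dualBasis c))ᵀ * b₀.toBasis.toMatrix c = 1 := by
    ext i j
    simp only [Matrix.mul_apply, Matrix.transpose_apply, Module.Basis.toMatrix_apply,
      b₀.coe_toBasis_repr_apply, b₀.repr_apply_apply, real_inner_comm (dualBasis c i)]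
    rw [b₀.sum_inner_mul_inner, inner_dualBasis, Matrix.one_apply]
    simp only [eq_comm]
  rw [Module.Basis.det_apply, Module.Basis.det_apply,
    ← Matrix.det_transpose (b₀.toBasis.toMatrix (dualBasis c)), ← Matrix.det_mul, transpose_mul,
    Matrix.det_one]

theorem FlatTorus.exists_dualLattice_eq_weightedLattice {d : ℕ}
    (b₀ : OrthonormalBasis ι ℝ (EuclideanSpace ℝ (Fin d))) (ha : ∀ i, a i ≠ 0)
    {M : Matrix ι ι ℤ} (hM : M.det ≠ 0) :
    ∃ b : Module.Basis (Fin d) ℝ (EuclideanSpace ℝ (Fin d)),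
      dualLattice (Submodule.span ℤ (Set.range b)) = weightedLattice b₀ a M ∧
      (vol b).real Set.univ =
        |M.det * ∏ i, √(a i)|⁻¹ * volume.real (ZSpan.fundamentalDomain b₀.toBasis) := by
  obtain ⟨c, span_eq, det_eq⟩ := exists_basis_weightedLattice b₀ ha hM
  let σ : ι ≃ Fin d := b₀.toBasis.indexEquiv (EuclideanSpace.basisFun (Fin d) ℝ).toBasis
  refine ⟨(dualBasis c).reindex σ, ?_, ?_⟩
  · rw [Module.Basis.range_reindex, dualLattice_span, dualBasis_dualBasis, span_eq]
  · rw [vol_real_univ, ZSpan.fundamentalDomain_reindex,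
      ZSpan.measureReal_fundamentalDomain (dualBasis c) volume b₀.toBasis, ← det_eq,
      eq_inv_of_mul_eq_one_left (det_dualBasis_mul_det b₀ c), abs_inv]

end WeightedLattice

/-! ### The Conway–Sloane lattices -/

section ConwaySloane

open scoped Matrix

/-- The generator matrices of the two Conway–Sloane lattices, before rescaling of the coordinates by
the weights; the lattices for `s = 1` and `s = -1` are isospectral for every choice of weights. -/
def conwaySloane (s : ℤˣ) : Matrix (Fin 4) (Fin 4) ℤ :=
  !![3 * s, -1, -1, -1; 1, 3 * s, -1, 1; 1, 1, 3 * s, -1; 1, -1, 1, 3 * s]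

theorem det_conwaySloane (s : ℤˣ) : (conwaySloane s).det = 144 := by
  revert s; decide +kernel

theorem conwaySloane_mul_transpose (s : ℤˣ) :
    conwaySloane s * (conwaySloane s)ᵀ = (12 : ℤ) • (1 : Matrix (Fin 4) (Fin 4) ℤ) := by
  revert s; decide +kernel

theorem mem_rowLattice_conwaySloane_iff_dvd_mulVec {s : ℤˣ} {v : Fin 4 → ℤ} :
    v ∈ rowLattice (conwaySloane s) ↔ ∀ i, 12 ∣ (conwaySloane s *ᵥ v) i :=
  mem_rowLattice_iff_dvd_mulVec (by norm_num) (conwaySloane_mul_transpose s)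

-- Modulo `3` both lattices reduce to the tetracode; they differ only modulo `4`, at odd vectors.
theorem mem_rowLattice_conwaySloane {s : ℤˣ} {v : Fin 4 → ℤ} :
    v ∈ rowLattice (conwaySloane s) ↔ (∀ i, 2 ∣ v i - v 0) ∧ 4 ∣ ∑ i, v i - (1 - s) * v 0 ∧
      3 ∣ v 2 - (v 1 - v 0) ∧ 3 ∣ v 3 - (v 0 + v 1) := by
  rw [mem_rowLattice_conwaySloane_iff_dvd_mulVec]
  simp only [conwaySloane, Matrix.mulVec, dotProduct, Fin.forall_fin_succ, Fin.sum_univ_four,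
    Matrix.of_apply, Matrix.cons_val, IsEmpty.forall_iff, Fin.succ_zero_eq_one,
    Fin.succ_one_eq_two, Fin.reduceSucc, and_true]
  rcases Int.units_eq_one_or s with rfl | rfl <;>
  simp only [Units.val_neg, Units.val_one] <;> omega

theorem exists_three_dvd_of_mem_conwaySloane {s : ℤˣ} {v : Fin 4 → ℤ}
    (hv : v ∈ rowLattice (conwaySloane s)) : ∃ i, 3 ∣ v i := by
  obtain ⟨-, -, h₂, h₃⟩ := mem_rowLattice_conwaySloane.1 hv
  by_contra! h
  have h₀ : v 0 % 3 = 1 ∨ v 0 % 3 = 2 := by have := h 0; omega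
  have h₁ : v 1 % 3 = 1 ∨ v 1 % 3 = 2 := by have := h 1; omega
  have := h 2
  have := h 3
  omega

theorem update_neg_mem_conwaySloane_neg {s : ℤˣ} {v : Fin 4 → ℤ} {i : Fin 4} (hi : 3 ∣ v i)
    (hv : v ∈ rowLattice (conwaySloane s)) :
    Function.update v i (-v i) ∈ rowLattice (conwaySloane (-s)) := by
  obtain ⟨parity, mod_four, mod_three⟩ := mem_rowLattice_conwaySloane.1 hv
  set w := Function.update v i (-v i) with hw
  have w_sub_v (j) : w j - v j = if j = i then -2 * v i else 0 := by
    rw [hw, Function.update_apply]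
    split_ifs with h
    · rw [h]; ring
    · exact sub_self _
  have two_dvd (j) : 2 ∣ w j - v j := by rw [w_sub_v]; split_ifs <;> omega
  have three_dvd (j) : 3 ∣ w j - v j := by rw [w_sub_v]; split_ifs <;> omega
  have sum_eq : ∑ j, w j = ∑ j, v j - 2 * v i := by
    have : ∑ j, (w j - v j) = -2 * v i := by simp [w_sub_v]
    rw [Finset.sum_sub_distrib] at this
    linarith
  refine mem_rowLattice_conwaySloane.2 ⟨fun j => ?_, ?_, ?_, ?_⟩
  · have := two_dvd j; have := two_dvd 0; have := parity j
    omega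
  · rw [sum_eq]
    have := two_dvd 0; have := parity i
    rcases Int.units_eq_one_or s with rfl | rfl <;>
    simp only [Units.val_neg, Units.val_one] at mod_four ⊢ <;> omega
  · have := three_dvd 0; have := three_dvd 1; have := three_dvd 2
    omega
  · have := three_dvd 0; have := three_dvd 1; have := three_dvd 3
    omega

/-- The norm-preserving bijection between the two Conway–Sloane lattices: change the sign of the
first coordinate divisible by `3`. -/
def signFlip (v : Fin 4 → ℤ) : Fin 4 → ℤ := fun i =>
  if 3 ∣ v i ∧ ∀ j < i, ¬3 ∣ v j then -v i else v i

theorem signFlip_eq_or_neg (v : Fin 4 → ℤ) (i : Fin 4) :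
    signFlip v i = v i ∨ signFlip v i = -v i :=
  (ite_eq_or_eq _ _ _).symm

theorem dvd_signFlip {n : ℤ} {v : Fin 4 → ℤ} {i : Fin 4} : n ∣ signFlip v i ↔ n ∣ v i := by
  rcases signFlip_eq_or_neg v i with h | h <;> rw [h]
  exact dvd_neg

theorem signFlip_sq (v : Fin 4 → ℤ) (i : Fin 4) : signFlip v i ^ 2 = v i ^ 2 :=
  sq_eq_sq_iff_eq_or_eq_neg.2 (signFlip_eq_or_neg v i)

theorem signFlip_involutive : Function.Involutive signFlip := by
  intro v
  funext i
  rw [signFlip]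
  simp only [dvd_signFlip]
  by_cases h : 3 ∣ v i ∧ ∀ j < i, ¬3 ∣ v j
  · rw [if_pos h, signFlip, if_pos h, neg_neg]
  · rw [if_neg h, signFlip, if_neg h]

theorem exists_signFlip_eq_update {v : Fin 4 → ℤ} (h : ∃ i, 3 ∣ v i) :
    ∃ i, 3 ∣ v i ∧ signFlip v = Function.update v i (-v i) := by
  obtain ⟨i, hi, hmin⟩ := wellFounded_lt.has_min {i | 3 ∣ v i} h
  refine ⟨i, hi, funext fun j => ?_⟩
  by_cases hj : j = i
  · subst hj
    rw [Function.update_self]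
    exact if_pos ⟨hi, fun k hk h3 => hmin k h3 hk⟩
  · rw [Function.update_of_ne hj]
    refine if_neg fun ⟨h3, hlt⟩ => ?_
    exact (lt_or_gt_of_ne hj).elim (hmin j h3) fun hij => hlt i hij hi

theorem signFlip_mem_conwaySloane_neg {s : ℤˣ} {v : Fin 4 → ℤ}
    (hv : v ∈ rowLattice (conwaySloane s)) : signFlip v ∈ rowLattice (conwaySloane (-s)) := by
  obtain ⟨i, hi, h⟩ := exists_signFlip_eq_update (exists_three_dvd_of_mem_conwaySloane hv)
  rw [h]
  exact update_neg_mem_conwaySloane_neg hi hv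

theorem mem_conwaySloane_iff_signFlip_mem {s : ℤˣ} {v : Fin 4 → ℤ} :
    v ∈ rowLattice (conwaySloane s) ↔ signFlip v ∈ rowLattice (conwaySloane (-s)) := by
  refine ⟨signFlip_mem_conwaySloane_neg, fun h => ?_⟩
  simpa only [signFlip_involutive v, neg_neg] using signFlip_mem_conwaySloane_neg h

theorem abs_le_of_diagForm_le {v : Fin 4 → ℤ} (h : diagForm ![1, 2, 3, 4] v v ≤ 26) (i : Fin 4) :
    |v i| ≤ ![5, 3, 2, 2] i := by
  have term_le : (![1, 2, 3, 4] i : ℕ) * (v i * v i) ≤ 26 :=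
    (Finset.single_le_sum (f := fun i => ((![1, 2, 3, 4] i : ℕ) : ℤ) * (v i * v i))
      (fun i _ => mul_nonneg (Nat.cast_nonneg _) (mul_self_nonneg _)) (Finset.mem_univ i)).trans h
  rw [abs_le]
  fin_cases i <;>
  simp only [Fin.zero_eta, Fin.mk_one, Fin.reduceFinMk, Matrix.cons_val, Nat.cast_one,
    Nat.cast_ofNat] at term_le ⊢ <;>
  constructor <;> nlinarith

theorem short_vectors_conwaySloane_neg_one {v : Fin 4 → ℤ}
    (hv : v ∈ rowLattice (conwaySloane (-1))) :
    (diagForm ![1, 2, 3, 4] v v = 18 → v = ![3, 1, 1, 1] ∨ v = -![3, 1, 1, 1]) ∧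
    (diagForm ![1, 2, 3, 4] v v = 26 → v = ![1, -3, -1, 1] ∨ v = -![1, -3, -1, 1]) := by
  have enumeration : ∀ v ∈ Fintype.piFinset fun i : Fin 4 =>
      Finset.Icc (-![5, 3, 2, 2] i : ℤ) (![5, 3, 2, 2] i),
      (∀ i, 12 ∣ (conwaySloane (-1) *ᵥ v) i) →
      (diagForm ![1, 2, 3, 4] v v = 18 → v = ![3, 1, 1, 1] ∨ v = -![3, 1, 1, 1]) ∧
      (diagForm ![1, 2, 3, 4] v v = 26 → v = ![1, -3, -1, 1] ∨ v = -![1, -3, -1, 1]) := by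
    decide +kernel
  by_cases h : diagForm ![1, 2, 3, 4] v v ≤ 26
  · refine enumeration v (Fintype.mem_piFinset.2 fun i => Finset.mem_Icc.2 ?_)
      (mem_rowLattice_conwaySloane_iff_dvd_mulVec.1 hv)
    exact abs_le.1 (abs_le_of_diagForm_le h i)
  · exact ⟨fun h' => absurd h' (by omega), fun h' => absurd h' (by omega)⟩

-- The first two rows of `conwaySloane 1` have norms `18`, `26` and inner product `-4`.
theorem diagForm_ne_of_mem_conwaySloane_neg_one {v w : Fin 4 → ℤ}
    (hv : v ∈ rowLattice (conwaySloane (-1))) (hw : w ∈ rowLattice (conwaySloane (-1)))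
    (hvv : diagForm ![1, 2, 3, 4] v v = 18) (hww : diagForm ![1, 2, 3, 4] w w = 26) :
    diagForm ![1, 2, 3, 4] v w ≠ -4 := by
  rcases (short_vectors_conwaySloane_neg_one hv).1 hvv with rfl | rfl <;>
  rcases (short_vectors_conwaySloane_neg_one hw).2 hww with rfl | rfl <;>
  decide

end ConwaySloane

section ConwaySloaneExtension

variable {κ : Type*}

/-- The weights `1, 2, 3, 4` on the Conway–Sloane coordinates and `30` on the others; as `30` is
larger than the norms `18` and `26` of the vectors telling the two lattices apart, these vectors lie
in the first block. -/
def conwaySloaneWeight : Fin 4 ⊕ κ → ℕ := Sum.elim ![1, 2, 3, 4] fun _ => 30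

theorem conwaySloaneWeight_ne_zero : ∀ i : Fin 4 ⊕ κ, conwaySloaneWeight i ≠ 0
  | .inl i => show ![1, 2, 3, 4] i ≠ 0 by revert i; decide
  | .inr _ => Nat.succ_ne_zero 29

variable [Fintype κ]

theorem diagForm_conwaySloaneWeight (x y : Fin 4 ⊕ κ → ℤ) :
    diagForm conwaySloaneWeight x y =
      diagForm ![1, 2, 3, 4] (x ∘ Sum.inl) (y ∘ Sum.inl) + 30 * ∑ j, x (.inr j) * y (.inr j) := by
  rw [diagForm, Fintype.sum_sum_type, Finset.mul_sum]
  rfl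

theorem inr_eq_zero_of_diagForm_lt {x : Fin 4 ⊕ κ → ℤ}
    (hx : diagForm conwaySloaneWeight x x < 30) (j : κ) : x (.inr j) = 0 := by
  have sq_nonneg (j) : 0 ≤ x (.inr j) * x (.inr j) := mul_self_nonneg _
  have form_nonneg : 0 ≤ diagForm ![1, 2, 3, 4] (x ∘ Sum.inl) (x ∘ Sum.inl) :=
    Finset.sum_nonneg fun _ _ => mul_nonneg (Nat.cast_nonneg _) (mul_self_nonneg _)
  have term_le := Finset.single_le_sum (fun j _ => sq_nonneg j) (Finset.mem_univ j)
  rw [diagForm_conwaySloaneWeight] at hx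
  exact mul_self_eq_zero.1 (le_antisymm (by omega) (sq_nonneg j))

variable [DecidableEq κ]

/-- The generator matrix of the sum of a Conway–Sloane lattice and a rectangular lattice. -/
def conwaySloaneSum (s : ℤˣ) : Matrix (Fin 4 ⊕ κ) (Fin 4 ⊕ κ) ℤ :=
  Matrix.fromBlocks (conwaySloane s) 0 0 1

theorem det_conwaySloaneSum (s : ℤˣ) : (conwaySloaneSum (κ := κ) s).det = 144 := by
  rw [conwaySloaneSum, Matrix.det_fromBlocks_zero₁₂, Matrix.det_one, mul_one, det_conwaySloane]

theorem mem_rowLattice_conwaySloaneSum {s : ℤˣ} {x : Fin 4 ⊕ κ → ℤ} :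
    x ∈ rowLattice (conwaySloaneSum s) ↔ x ∘ Sum.inl ∈ rowLattice (conwaySloane s) :=
  mem_rowLattice_fromBlocks

variable {E : Type*} [NormedAddCommGroup E] [InnerProductSpace ℝ E]
  (b₀ : OrthonormalBasis (Fin 4 ⊕ κ) ℝ E)

theorem exists_equiv_conwaySloaneSum_neg (s : ℤˣ) :
    ∃ e : weightedLattice b₀ conwaySloaneWeight (conwaySloaneSum s) ≃
        weightedLattice b₀ conwaySloaneWeight (conwaySloaneSum (-s)), ∀ ξ, ‖e ξ‖ = ‖ξ‖ := by
  have flip_involutive : Function.Involutive fun x : Fin 4 ⊕ κ → ℤ =>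
      Sum.elim (signFlip (x ∘ Sum.inl)) (x ∘ Sum.inr) := fun x => by
    simp only [Sum.elim_comp_inl, Sum.elim_comp_inr, signFlip_involutive _, Sum.elim_comp_inl_inr]
  refine exists_equiv_weightedLattice b₀ conwaySloaneWeight_ne_zero flip_involutive.toPerm
    (fun x => ?_) fun x i => ?_
  · rw [mem_rowLattice_conwaySloaneSum, mem_rowLattice_conwaySloaneSum,
      mem_conwaySloane_iff_signFlip_mem]
    rfl
  · rcases i with i | i
    · exact signFlip_sq _ i
    · rfl

theorem not_exists_linearIsometry_conwaySloaneSum :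
    ¬∃ B : E →ₗᵢ[ℝ] E, ∀ ξ ∈ weightedLattice b₀ conwaySloaneWeight (conwaySloaneSum 1),
      B ξ ∈ weightedLattice b₀ conwaySloaneWeight (conwaySloaneSum (-1)) := by
  rintro ⟨B, hB⟩
  let row (i : Fin 4) : Fin 4 ⊕ κ → ℤ := Sum.elim (conwaySloane 1 i) 0
  have exists_image (i) : ∃ x ∈ rowLattice (conwaySloaneSum (-1)),
      weightedVec b₀ conwaySloaneWeight x = B (weightedVec b₀ conwaySloaneWeight (row i)) :=
    hB _ (Submodule.mem_map_of_mem (mem_rowLattice_conwaySloaneSum.2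
      ⟨Pi.single i 1, Matrix.single_one_vecMul i (conwaySloane 1)⟩))
  choose x x_mem x_eq using exists_image
  have form_eq (i j) : diagForm conwaySloaneWeight (x i) (x j) =
      diagForm ![1, 2, 3, 4] (conwaySloane 1 i) (conwaySloane 1 j) := by
    have := inner_weightedVec b₀ (a := conwaySloaneWeight) (x i) (x j)
    rw [x_eq, x_eq, B.inner_map_map, inner_weightedVec, Int.cast_inj] at this
    rw [← this, diagForm_conwaySloaneWeight]
    simp [row]
  have restrict_eq {i : Fin 4} (j) (hi : diagForm conwaySloaneWeight (x i) (x i) < 30) :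
      diagForm ![1, 2, 3, 4] (x i ∘ Sum.inl) (x j ∘ Sum.inl) =
        diagForm ![1, 2, 3, 4] (conwaySloane 1 i) (conwaySloane 1 j) := by
    rw [← form_eq, diagForm_conwaySloaneWeight]
    simp [inr_eq_zero_of_diagForm_lt hi]
  have norm_zero : diagForm conwaySloaneWeight (x 0) (x 0) = 18 := form_eq 0 0
  have norm_one : diagForm conwaySloaneWeight (x 1) (x 1) = 26 := form_eq 1 1
  exact diagForm_ne_of_mem_conwaySloane_neg_one (mem_rowLattice_conwaySloaneSum.1 (x_mem 0))
    (mem_rowLattice_conwaySloaneSum.1 (x_mem 1)) (restrict_eq 0 (by omega))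
    (restrict_eq 1 (by omega)) (restrict_eq 1 (by omega))

end ConwaySloaneExtension

/-- `≃ᵢ` are the bijective isometries for the Riemannian distances; in particular an empty type
`FlatTorus b ≃ᵢ FlatTorus b'` excludes every Riemannian isometry. -/
theorem proposition1p2 (d : ℕ) (hd : 4 ≤ d) :
    ∃ b b' : Module.Basis (Fin d) ℝ (EuclideanSpace ℝ (Fin d)),
      IsEmpty (FlatTorus b ≃ᵢ FlatTorus b') ∧
      Nonempty (FlatTorus.EigenSystem b) ∧
      Nonempty (FlatTorus.EigenSystem b') ∧
      ∃ f : ℝ → ℝ≥0,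
        (∀ (S : FlatTorus.EigenSystem b) (x : FlatTorus b) (t : ℝ),
          FlatTorus.localWeyl S x t = (f t : ℝ≥0∞)) ∧
        (∀ (S' : FlatTorus.EigenSystem b') (y : FlatTorus b') (t : ℝ),
          FlatTorus.localWeyl S' y t = (f t : ℝ≥0∞)) := by
  obtain ⟨k, rfl⟩ := Nat.exists_eq_add_of_le hd
  have : NeZero (4 + k) := ⟨by omega⟩
  let b₀ := (EuclideanSpace.basisFun (Fin (4 + k)) ℝ).reindex finSumFinEquiv.symm
  choose b dual_eq vol_eq using fun s => FlatTorus.exists_dualLattice_eq_weightedLattice b₀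
    conwaySloaneWeight_ne_zero (M := conwaySloaneSum s) (by rw [det_conwaySloaneSum]; decide)
  have exists_equiv : ∃ e : FlatTorus.Frequency (b 1) ≃ FlatTorus.Frequency (b (-1)),
      ∀ ξ, ‖e ξ‖ = ‖ξ‖ := by
    unfold FlatTorus.Frequency
    rw [dual_eq, dual_eq]
    exact exists_equiv_conwaySloaneSum_neg b₀ 1
  obtain ⟨e, norm_e⟩ := exists_equiv
  refine ⟨b 1, b (-1), ⟨fun φ => ?_⟩, FlatTorus.nonempty_eigenSystem _,
    FlatTorus.nonempty_eigenSystem _, FlatTorus.exists_localWeyl_eq ?_ e norm_e⟩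
  · have := FlatTorus.exists_linearIsometry_map_dualLattice φ.symm.isometry
    rw [dual_eq, dual_eq] at this
    exact not_exists_linearIsometry_conwaySloaneSum b₀ this
  · rw [vol_eq, vol_eq, det_conwaySloaneSum, det_conwaySloaneSum]
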